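/- Let $B>0$, $f_c\in\mathbb R$, and $\operatorname{sinc}(x)=\sin(\pi x)/(\pi x)$, $\operatorname{sinc}(0)=1$. Let $s_\ell(k)\sim\mathcal{CN}(0,\rho_\ell)$, $k\in\mathbb Z$, be circularly symmetric complex Gaussian symbols, independent at different sampling points (pairwise independence is enough; in particular i.i.d. symbols are covered). Let the Tx noise $n_t(t)$ be a centred band-limited white complex Gaussian process, $\mathbb E[n_t(t)n_t^*(t+\tau)]=\rho_{n_t}\operatorname{sinc}(B\tau)$, such that each $s_\ell(k)$ and $n_t(t)$ are jointly Gaussian and uncorrelated, i.e. $\mathbb E[s_\ell(k)n_t^*(t)]=\mathbb E[s_\ell(k)n_t(t)]=0$. With IQ imbalance $u_k=b_0s_\ell(k)+b_1s_\ell^*(k)$, $b_0,b_1\in\mathbb C$, and with $v_k=u_k$ for all $k$ or $v_k=u_k^*$ for all $k$, let the nonlinear samples be $a_k=\sum_{p=3,5,7,\dots}c_p|v_k|^{p-1}v_k$, where $c_p\in\mathbb C$, the series converges almost surely and $\mathbb E|a_k|^2<\infty$ (both are automatic for a polynomial). The baseband Tx signal is $$s_b(t)=\sum_{k\in\mathbb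 Z}u_k\operatorname{sinc}(Bt-k)+\sum_{k\in\mathbb Z}a_k\operatorname{sinc}(Bt-k)+n_t(t),$$ the series being summed in mean square. Then $s_b$ has a power spectral density $P_s$ (a nonnegative integrable function whose inverse Fourier transform is the time-averaged autocorrelation of $s_b$), and the average Tx power $\lim_{T\to\infty}\frac1{2T}\int_{-T}^{T}\mathbb E|s_b(t)|^2\,dt$ exists and equals $\rho_t:=\int_{\mathbb R}P_s(f)\,df$. Let $h_{SI}=\sum_{m=0}^{M}\alpha_m\delta(\cdot-\tau_m)$ be any deterministic multipath channel and, for fixed delays $d_1,\dots,d_N\in\mathbb R$ and weights $w\in\mathbb C^N$, let $\tilde h_{SI}=\sum_{n=1}^{N}w_ne^{-j2\pi f_cd_n}\delta(\cdot-d_n)$ be the multiple-tap-delay (MTD) canceller; let $H_{SI}$, $\tilde H_{SI}$ be their Fourier transforms and $\varepsilon(t)=\big((h_{SI}-\tilde h_{SI})*s_b\big)(t)$ the approximation error. Then for every $w\in\mathbb C^N$ $$\lim_{T\to\infty}\frac1{2T}\int_{-T}^{T}\mathbb E|\varepsilon(t)|^2\,dt=\frac{\rho_t}{B}\int_{-B/2}^{B/2}\big|H_{SI}(f)-\tilde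 H_{SI}(f)\big|^2\,df=\rho_t\,\mathbb E\big|\big((h_{SI}-\tilde h_{SI})*x\big)(t)\big|^2\quad\text{for all }t,$$ where $x$ is any stationary (centred) Gaussian process with autocorrelation $\operatorname{sinc}(B\tau)$. Consequently the minima over $w\in\mathbb C^N$ of the three expressions exist and are equal: the minimal time-averaged mean square error is the Wiener-filter error for $x$. -/

import Mathlib

open MeasureTheory ProbabilityTheory Filter Topology
open scoped NNReal ComplexConjugate

noncomputable section

/-- The normalized cardinal sine `sin (π x) / (π x)`, equal to `1` at `0`. -/
def nsinc (x : ℝ) : ℝ := Real.sinc (Real.pi * x)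

/-- The circularly symmetric complex Gaussian law `CN(0, v)`: the real and the imaginary part are
independent centred real Gaussians of variance `v / 2`. -/
def circGaussian (v : ℝ≥0) : Measure ℂ :=
  ((gaussianReal 0 (v / 2)).prod (gaussianReal 0 (v / 2))).map
    (fun p : ℝ × ℝ => (⟨p.1, p.2⟩ : ℂ))

/-- `a` is the time average `lim_{T → ∞} (1 / 2T) ∫_{-T}^{T} g(t) dt` of `g`. -/
def HasTimeAverage {E : Type*} [NormedAddCommGroup E] [NormedSpace ℝ E]
    (g : ℝ → E) (a : E) : Prop :=
  (∀ T : ℝ, IntervalIntegrable g volume (-T) T) ∧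
    Tendsto (fun T : ℝ => (2 * T)⁻¹ • ∫ t in (-T)..T, g t) atTop (𝓝 a)

/-- I/Q imbalance acting on a symbol. -/
def iqImbalance (b₀ b₁ z : ℂ) : ℂ := b₀ * z + b₁ * conj z

/-- The term of odd order `p = 2 j + 3` of the power amplifier nonlinearity. -/
def paTerm (c : ℕ → ℂ) (v : ℂ) (j : ℕ) : ℂ :=
  c (2 * j + 3) * (‖v‖ : ℂ) ^ (2 * j + 2) * v

/-- The nonlinear component `∑_{p = 3, 5, 7, …} c_p |v|^(p-1) v`. -/
def paNonlinear (c : ℕ → ℂ) (v : ℂ) : ℂ := ∑' j : ℕ, paTerm c v j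

/-- The continuous-time process `X` is the sinc interpolation
`X(t) = ∑_{k ∈ ℤ} a_k sinc(B t - k)` of the random samples `a_k`, the series being summed
in mean square. -/
def IsSincInterpolation {Ω : Type*} [MeasurableSpace Ω] (μ : Measure Ω) (B : ℝ)
    (a : ℤ → Ω → ℂ) (X : ℝ → Ω → ℂ) : Prop :=
  ∀ t : ℝ, MemLp (X t) 2 μ ∧
    Tendsto (fun F : Finset ℤ =>
      eLpNorm (fun ω => X t ω - ∑ k ∈ F, a k ω * (nsinc (B * t - k) : ℂ)) 2 μ) atTop (𝓝 0)

/-- `X` is a centred Gaussian process with autocorrelation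
`E[X(t) X(t + τ)^*] = ρ sinc(B τ)`. -/
structure IsBandlimitedWhiteGaussian {Ω : Type*} [MeasurableSpace Ω] (μ : Measure Ω) (B ρ : ℝ)
    (X : ℝ → Ω → ℂ) : Prop where
  gaussian : IsGaussianProcess X μ
  centred : ∀ t, ∫ ω, X t ω ∂μ = 0
  autocorr : ∀ t τ, ∫ ω, X t ω * conj (X (t + τ) ω) ∂μ = ((ρ * nsinc (B * τ) : ℝ) : ℂ)

/-- `P` is a power spectral density of `X`: a nonnegative integrable function whose inverse Fourier
transform is the time-averaged autocorrelation `τ ↦ ⟨E[X(t + τ) X(t)^*]⟩_t`. -/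
structure IsPSD {Ω : Type*} [MeasurableSpace Ω] (μ : Measure Ω) (X : ℝ → Ω → ℂ)
    (P : ℝ → ℝ) : Prop where
  nonneg : ∀ f, 0 ≤ P f
  integrable : Integrable P
  autocorr : ∀ τ : ℝ, HasTimeAverage (fun t : ℝ => ∫ ω, X (t + τ) ω * conj (X t ω) ∂μ)
    (∫ f : ℝ, (P f : ℂ) * Complex.exp (2 * Real.pi * f * τ * Complex.I))

/-- Convolution of the process `X` with the impulse response `∑ i, a i δ(t - τ i)`. -/
def tapConv {Ω ι : Type*} [Fintype ι] (a : ι → ℂ) (τ : ι → ℝ) (X : ℝ → Ω → ℂ)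
    (t : ℝ) (ω : Ω) : ℂ := ∑ i, a i * X (t - τ i) ω

/-- The frequency response, i.e. the Fourier transform of `∑ i, a i δ(t - τ i)`. -/
def tapFreq {ι : Type*} [Fintype ι] (a : ι → ℂ) (τ : ι → ℝ) (f : ℝ) : ℂ :=
  ∑ i, a i * Complex.exp (-(2 * Real.pi * f * τ i * Complex.I))

/-- The baseband coefficients `w_n exp(-j 2π f_c d_n)` of the multiple-tap-delay canceller. -/
def mtdCoeff {N : ℕ} (fc : ℝ) (d : Fin N → ℝ) (w : Fin N → ℂ) (i : Fin N) : ℂ :=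
  w i * Complex.exp (-(2 * Real.pi * fc * d i * Complex.I))

/-- The approximation error: the process `X` sent through the channel `(α, τ)`, minus `X` sent
through the canceller with weights `w` and delays `d`. -/
def approxError {Ω : Type*} {M N : ℕ} (fc : ℝ) (α : Fin (M + 1) → ℂ) (τ : Fin (M + 1) → ℝ)
    (d : Fin N → ℝ) (w : Fin N → ℂ) (X : ℝ → Ω → ℂ) (t : ℝ) (ω : Ω) : ℂ :=
  tapConv α τ X t ω - tapConv (mtdCoeff fc d w) d X t ω

/-- The mean square error `E |ε(t)|²` of the approximation error driven by `X`. -/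
def mse {Ω : Type*} [MeasurableSpace Ω] (μ : Measure Ω) {M N : ℕ} (fc : ℝ)
    (α : Fin (M + 1) → ℂ) (τ : Fin (M + 1) → ℝ) (d : Fin N → ℝ) (X : ℝ → Ω → ℂ)
    (w : Fin N → ℂ) (t : ℝ) : ℝ :=
  ∫ ω, ‖approxError fc α τ d w X t ω‖ ^ 2 ∂μ

/-- `∫_{-B/2}^{B/2} |H_SI(f) - H̃_SI(f)|² df`. -/
def bandMismatch {M N : ℕ} (B fc : ℝ) (α : Fin (M + 1) → ℂ) (τ : Fin (M + 1) → ℝ)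
    (d : Fin N → ℝ) (w : Fin N → ℂ) : ℝ :=
  ∫ f in (-(B / 2))..(B / 2), ‖tapFreq α τ f - tapFreq (mtdCoeff fc d w) d f‖ ^ 2

end

/-! Everything reduces to second-order statistics: $s_b$ is white in band,
$E[s_b(t)s_b(u)^*]=\rho_t\operatorname{sinc}(B(t-u))$. The linear and nonlinear samples add up to
$g(s_k)$ with a single odd $g$. As $\mathcal{CN}(0,\rho_\ell)$ is symmetric under negation, $g(s_k)$
has mean zero, so independence makes these samples uncorrelated, with common power. Parseval for the
sincs (`hasSum_nsinc_mul_nsinc`) turns white samples into a white interpolation.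

Jointly Gaussian variables with zero covariance and pseudo-covariance are independent, so the noise
at each time is orthogonal to each $g(s_k)$ and simply adds its power.

Since the sinc is the Fourier transform of the flat band, the power after any tap filter is
$\rho/B\int|H|^2$ at every $t$ (`integral_norm_sq_tapConv`); the time averages are averages of
constants. The Gaussian reference process has the same correlations up to the factor $\rho_t$. A
common minimiser comes from projecting onto a finite-dimensional subspace of $L^2$ of the band. -/

/-! ### Fourier analysis of the cardinal sine -/

/-- The integral of a complex exponential over a symmetric band is a cardinal sine. -/
theorem integral_exp_band (B τ : ℝ) :
    ∫ f in (-(B / 2))..(B / 2), Complex.exp (2 * Real.pi * f * τ * Complex.I) =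
      ((B * nsinc (B * τ) : ℝ) : ℂ) := by
  rcases eq_or_ne τ 0 with rfl | hτ
  · simp [nsinc, Complex.real_smul]
  rcases eq_or_ne B 0 with rfl | hB
  · simp
  have hπ := Real.pi_ne_zero
  have hc : (2 * Real.pi * τ * Complex.I : ℂ) ≠ 0 := by
    simp [hτ, hπ]
  have h := integral_exp_mul_complex (a := -(B / 2)) (b := B / 2) hc
  have e : ∀ f : ℝ, (2 * Real.pi * f * τ * Complex.I : ℂ) = 2 * Real.pi * τ * Complex.I * f :=
    fun f => by ring
  simp_rw [e, h]
  rw [nsinc, Real.sinc_of_ne_zero (by positivity)]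
  push_cast
  rw [Complex.sin]
  have e1 : (2 * Real.pi * τ * Complex.I * (B / 2) : ℂ) = Real.pi * (B * τ) * Complex.I := by ring
  have e2 : (2 * Real.pi * τ * Complex.I * -(B / 2) : ℂ) = -(Real.pi * (B * τ)) * Complex.I := by
    ring
  rw [e1, e2]
  have hB' : (B : ℂ) ≠ 0 := by exact_mod_cast hB
  have hτ' : (τ : ℂ) ≠ 0 := by exact_mod_cast hτ
  have hπ' : (Real.pi : ℂ) ≠ 0 := by exact_mod_cast hπ
  field_simp
  rw [Complex.I_sq]
  ring

theorem nsinc_neg (x : ℝ) : nsinc (-x) = nsinc x := by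
  simp [nsinc]

theorem nsinc_zero : nsinc 0 = 1 := by
  simp [nsinc]

theorem norm_exp_two_pi_mul_I (x y : ℝ) :
    ‖Complex.exp (2 * Real.pi * x * y * Complex.I)‖ = 1 := by
  have := Complex.norm_exp_ofReal_mul_I (2 * Real.pi * x * y)
  push_cast at this
  exact this

theorem conj_exp_two_pi_mul_I (x y : ℝ) :
    conj (Complex.exp (2 * Real.pi * x * y * Complex.I)) =
      Complex.exp (-(2 * Real.pi * x * y * Complex.I)) := by
  rw [← Complex.exp_conj]
  simp [map_ofNat]

theorem memLp_two_exp (x : ℝ) (μ : Measure ℝ) [IsFiniteMeasure μ] :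
    MemLp (fun f : ℝ => Complex.exp (2 * Real.pi * f * x * Complex.I)) 2 μ :=
  MemLp.of_bound (Continuous.aestronglyMeasurable (by fun_prop)) 1
    (ae_of_all _ fun f => (norm_exp_two_pi_mul_I f x).le)

/-- Parseval's identity for the cardinal sines: `∑ₖ sinc (x - k) sinc (y - k) = sinc (x - y)`. -/
theorem hasSum_nsinc_mul_nsinc (x y : ℝ) :
    HasSum (fun k : ℤ => nsinc (x - k) * nsinc (y - k)) (nsinc (x - y)) := by
  have : Fact ((0 : ℝ) < 1) := ⟨one_pos⟩
  -- On a period of length 1 centred at 0, the $k$-th Fourier coefficient of $f\mapsto e^{2\pi i f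
  -- x}$ is $\operatorname{sinc}(x-k)$; the claim is Parseval for two such functions.
  let e : ℝ → ℝ → ℂ := fun x f => Complex.exp (2 * Real.pi * f * x * Complex.I)
  let a : ℝ := -(1 / 2)
  have hmem : ∀ x, MemLp (AddCircle.liftIoc 1 a (e x)) 2 (@AddCircle.haarAddCircle 1 _) :=
    fun x => (memLp_two_exp x _).memLp_liftIoc.haarAddCircle
  have hcoef : ∀ (x : ℝ) (k : ℤ), fourierCoeff ((hmem x).toLp : AddCircle (1 : ℝ) → ℂ) k =
      (nsinc (x - k) : ℂ) := by
    intro x k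
    rw [fourierCoeff_congr_ae (hmem x).coeFn_toLp, fourierCoeff_liftIoc_eq,
      fourierCoeffOn_eq_integral]
    have h := integral_exp_band 1 (x - k)
    simp only [one_mul] at h
    have hab : a + 1 = 1 / 2 := by norm_num [a]
    rw [← h, hab]
    norm_num [a]
    refine intervalIntegral.integral_congr fun f _ => ?_
    have hk := conj_exp_two_pi_mul_I f k
    rw [show (2 * Real.pi * f * (k : ℝ) * Complex.I : ℂ) =
      2 * Real.pi * Complex.I * k * f by push_cast; ring] at hk
    simp only [e]
    rw [hk, ← Complex.exp_add]
    congr 1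
    ring
  have h := fourierBasis.hasSum_inner_mul_inner (hmem y).toLp (hmem x).toLp
  have hi : inner ℂ ((hmem y).toLp) ((hmem x).toLp) = (nsinc (x - y) : ℂ) := by
    rw [L2.inner_def]
    have : ∫ t, inner ℂ (((hmem y).toLp : AddCircle (1 : ℝ) → ℂ) t)
          (((hmem x).toLp : AddCircle (1 : ℝ) → ℂ) t) ∂AddCircle.haarAddCircle =
        ∫ t, AddCircle.liftIoc 1 a (e (x - y)) t ∂(@AddCircle.haarAddCircle 1 _) := by
      apply integral_congr_ae
      filter_upwards [(hmem x).coeFn_toLp, (hmem y).coeFn_toLp] with t hx hy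
      rw [hx, hy]
      obtain ⟨f, hf, rfl⟩ : ∃ f ∈ Set.Ioc a (a + 1), (f : AddCircle (1 : ℝ)) = t := by
        have := AddCircle.coe_image_Ioc_eq (1 : ℝ) a
        have ht : t ∈ ((↑) '' Set.Ioc a (a + 1) : Set (AddCircle (1 : ℝ))) := by
          rw [this]; trivial
        exact ht
      rw [AddCircle.liftIoc_coe_apply hf, AddCircle.liftIoc_coe_apply hf,
        AddCircle.liftIoc_coe_apply hf]
      simp only [RCLike.inner_apply, e]
      rw [conj_exp_two_pi_mul_I, ← Complex.exp_add]
      congr 1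
      push_cast
      ring
    rw [this]
    have h1 := integral_exp_band 1 (x - y)
    have h2 := AddCircle.integral_liftIoc_eq_intervalIntegral (1 : ℝ) (t := a) (f := e (x - y))
    rw [AddCircle.integral_haarAddCircle, h2]
    have hab : a + 1 = 1 / 2 := by norm_num [a]
    simp only [one_mul] at h1
    rw [← h1, hab]
    simp [a, e]
  rw [hi] at h
  have hterm : ∀ k, inner ℂ ((hmem y).toLp) (fourierBasis k) *
      inner ℂ (fourierBasis k) ((hmem x).toLp) =
        ((nsinc (x - k) * nsinc (y - k) : ℝ) : ℂ) := by
    intro k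
    have h1 := fourierBasis.repr_apply_apply (hmem x).toLp k
    have h2 := fourierBasis.repr_apply_apply (hmem y).toLp k
    rw [fourierBasis_repr, hcoef] at h1 h2
    rw [← h1, ← inner_conj_symm, ← h2]
    simp [mul_comm]
  simp_rw [hterm] at h
  exact_mod_cast h

/-! ### Least squares over the canceller weights -/

/-- The distance to the range of a linear map with finite-dimensional domain is attained. -/
theorem exists_forall_norm_sub_le {E F : Type*} [NormedAddCommGroup E] [InnerProductSpace ℂ E]
    [AddCommGroup F] [Module ℂ F] [FiniteDimensional ℂ F] (L : F →ₗ[ℂ] E) (a : E) :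
    ∃ c₀, ∀ c, ‖a - L c₀‖ ≤ ‖a - L c‖ := by
  have hc : IsComplete (L.range : Set E) := by
    rw [← completeSpace_coe_iff_isComplete]
    exact FiniteDimensional.complete ℂ L.range
  obtain ⟨v, ⟨c₀, rfl⟩, hv⟩ := L.range.exists_norm_eq_iInf_of_complete_subspace hc a
  refine ⟨c₀, fun c => ?_⟩
  rw [hv]
  exact ciInf_le ⟨0, by rintro _ ⟨w, rfl⟩; exact norm_nonneg _⟩ (⟨L c, c, rfl⟩ : L.range)

theorem integral_norm_sq_eq_norm_toLp_sq {α : Type*} [MeasurableSpace α] {μ : Measure α}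
    {f : α → ℂ} (hf : MemLp f 2 μ) : ∫ x, ‖f x‖ ^ 2 ∂μ = ‖hf.toLp‖ ^ 2 := by
  have h := L2.inner_def (𝕜 := ℂ) hf.toLp hf.toLp
  rw [inner_self_eq_norm_sq_to_K] at h
  have : ∫ x, inner ℂ ((hf.toLp : α → ℂ) x) ((hf.toLp : α → ℂ) x) ∂μ =
      ((∫ x, ‖f x‖ ^ 2 ∂μ : ℝ) : ℂ) := by
    rw [← integral_complex_ofReal]
    apply integral_congr_ae
    filter_upwards [hf.coeFn_toLp] with x hx
    rw [hx, inner_self_eq_norm_sq_to_K]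
    simp
  rw [this] at h
  exact Complex.ofReal_injective (h.symm.trans (by simp))

theorem memLp_two_tapFreq {ι : Type*} [Fintype ι] (a : ι → ℂ) (τ : ι → ℝ) (μ : Measure ℝ)
    [IsFiniteMeasure μ] : MemLp (tapFreq a τ) 2 μ := by
  have : ∀ i, MemLp (fun f : ℝ => a i * Complex.exp (-(2 * Real.pi * f * τ i * Complex.I))) 2 μ :=
    fun i => by
      have := (memLp_two_exp (-τ i) μ).const_mul (a i)
      simpa using this
  exact memLp_finsetSum _ fun i _ => this i

/-- The mismatch over the band attains its minimum over the weights of the canceller. -/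
theorem exists_forall_bandMismatch_le {M N : ℕ} {B : ℝ} (hB : 0 < B) (fc : ℝ)
    (α : Fin (M + 1) → ℂ) (τ : Fin (M + 1) → ℝ) (d : Fin N → ℝ) :
    ∃ w₀, ∀ w, bandMismatch B fc α τ d w₀ ≤ bandMismatch B fc α τ d w := by
  let ν : Measure ℝ := volume.restrict (Set.Ioc (-(B / 2)) (B / 2))
  let L : (Fin N → ℂ) →ₗ[ℂ] Lp ℂ 2 ν :=
    { toFun := fun w => (memLp_two_tapFreq (mtdCoeff fc d w) d ν).toLp
      map_add' := fun v w => by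
        rw [← MemLp.toLp_add]
        congr 1
        ext f
        simp [tapFreq, mtdCoeff, add_mul, Finset.sum_add_distrib]
      map_smul' := fun r w => by
        rw [RingHom.id_apply, ← MemLp.toLp_const_smul]
        congr 1
        ext f
        simp [tapFreq, mtdCoeff, Finset.mul_sum, mul_assoc] }
  have key : ∀ w, bandMismatch B fc α τ d w =
      ‖(memLp_two_tapFreq α τ ν).toLp - L w‖ ^ 2 := by
    intro w
    rw [bandMismatch, intervalIntegral.integral_of_le (by linarith)]
    change _ = ‖(memLp_two_tapFreq α τ ν).toLp - (memLp_two_tapFreq (mtdCoeff fc d w) d ν).toLp‖ ^ 2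
    rw [← MemLp.toLp_sub, ← integral_norm_sq_eq_norm_toLp_sq]
    rfl
  obtain ⟨w₀, h⟩ := exists_forall_norm_sub_le L (memLp_two_tapFreq α τ ν).toLp
  refine ⟨w₀, fun w => ?_⟩
  rw [key, key]
  exact pow_le_pow_left₀ (norm_nonneg _) (h w) 2

/-! ### Mean-square calculus and sinc interpolation -/

section SecondOrder

variable {Ω : Type*} [MeasurableSpace Ω] {μ : Measure Ω}

theorem MeasureTheory.MemLp.integrable_mul_conj {X Y : Ω → ℂ} (hX : MemLp X 2 μ)
    (hY : MemLp Y 2 μ) :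
    Integrable (fun ω => X ω * conj (Y ω)) μ :=
  hX.integrable_mul hY.star

theorem integral_mul_conj_eq_inner_toLp {X Y : Ω → ℂ} (hX : MemLp X 2 μ) (hY : MemLp Y 2 μ) :
    ∫ ω, X ω * conj (Y ω) ∂μ = inner ℂ hY.toLp hX.toLp := by
  rw [L2.inner_def]
  apply integral_congr_ae
  filter_upwards [hX.coeFn_toLp, hY.coeFn_toLp] with ω h1 h2
  rw [h1, h2, RCLike.inner_apply]

/-- Correlations are continuous for convergence in mean square. -/
theorem tendsto_integral_mul_conj {ι : Type*} {l : Filter ι} {F G : ι → Ω → ℂ} {X Y : Ω → ℂ}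
    (hF : ∀ i, MemLp (F i) 2 μ) (hG : ∀ i, MemLp (G i) 2 μ) (hX : MemLp X 2 μ) (hY : MemLp Y 2 μ)
    (hFX : Tendsto (fun i => eLpNorm (F i - X) 2 μ) l (𝓝 0))
    (hGY : Tendsto (fun i => eLpNorm (G i - Y) 2 μ) l (𝓝 0)) :
    Tendsto (fun i => ∫ ω, F i ω * conj (G i ω) ∂μ) l (𝓝 (∫ ω, X ω * conj (Y ω) ∂μ)) := by
  have h1 := (Lp.tendsto_Lp_iff_tendsto_eLpNorm'' F hF X hX).2 hFX
  have h2 := (Lp.tendsto_Lp_iff_tendsto_eLpNorm'' G hG Y hY).2 hGY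
  simp_rw [integral_mul_conj_eq_inner_toLp hX hY,
    fun i => integral_mul_conj_eq_inner_toLp (hF i) (hG i)]
  exact h2.inner h1

theorem ofReal_integral_norm_sq (X : Ω → ℂ) :
    ((∫ ω, ‖X ω‖ ^ 2 ∂μ : ℝ) : ℂ) = ∫ ω, X ω * conj (X ω) ∂μ := by
  rw [← integral_complex_ofReal]
  simp_rw [Complex.mul_conj', Complex.ofReal_pow]

namespace IsSincInterpolation

variable {B : ℝ} {a b : ℤ → Ω → ℂ} {X Y : ℝ → Ω → ℂ}

theorem memLp_sum (ha : ∀ k, MemLp (a k) 2 μ) (B t : ℝ) (F : Finset ℤ) :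
    MemLp (fun ω => ∑ k ∈ F, a k ω * (nsinc (B * t - k) : ℂ)) 2 μ :=
  memLp_finsetSum _ fun k _ => (ha k).mul_const _

theorem tendsto_sub (h : IsSincInterpolation μ B a X) (t : ℝ) :
    Tendsto (fun F : Finset ℤ =>
      eLpNorm ((fun ω => ∑ k ∈ F, a k ω * (nsinc (B * t - k) : ℂ)) - X t) 2 μ) atTop (𝓝 0) := by
  refine (h t).2.congr fun F => ?_
  rw [eLpNorm_sub_comm]
  rfl

theorem add (hX : IsSincInterpolation μ B a X) (hY : IsSincInterpolation μ B b Y)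
    (ha : ∀ k, MemLp (a k) 2 μ) (hb : ∀ k, MemLp (b k) 2 μ) :
    IsSincInterpolation μ B (fun k ω => a k ω + b k ω) (fun t ω => X t ω + Y t ω) := by
  refine fun t => ⟨(hX t).1.add (hY t).1, ?_⟩
  have h0 := (hX t).2.add (hY t).2
  rw [add_zero] at h0
  refine tendsto_of_tendsto_of_tendsto_of_le_of_le tendsto_const_nhds h0
    (fun _ => zero_le) fun F => ?_
  refine le_trans (le_of_eq ?_) (eLpNorm_add_le
    ((hX t).1.sub (memLp_sum ha B t F)).aestronglyMeasurable
    ((hY t).1.sub (memLp_sum hb B t F)).aestronglyMeasurable one_le_two)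
  congr 1
  ext ω
  simp only [Pi.add_apply, add_mul, Finset.sum_add_distrib]
  ring

/-- The sinc interpolation of white samples is a white process. -/
theorem integral_mul_conj (h : IsSincInterpolation μ B a X) (ha : ∀ k, MemLp (a k) 2 μ) {r : ℝ}
    (hself : ∀ k, ∫ ω, a k ω * conj (a k ω) ∂μ = r)
    (hne : ∀ j k, j ≠ k → ∫ ω, a j ω * conj (a k ω) ∂μ = 0) (t u : ℝ) :
    ∫ ω, X t ω * conj (X u ω) ∂μ = ((r * nsinc (B * (t - u)) : ℝ) : ℂ) := by
  have h1 := tendsto_integral_mul_conj (memLp_sum ha B t) (memLp_sum ha B u) (h t).1 (h u).1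
    (h.tendsto_sub t) (h.tendsto_sub u)
  have h2 : ∀ F : Finset ℤ, ∫ ω, (∑ k ∈ F, a k ω * (nsinc (B * t - k) : ℂ)) *
      conj (∑ k ∈ F, a k ω * (nsinc (B * u - k) : ℂ)) ∂μ =
      ((∑ k ∈ F, r * (nsinc (B * t - k) * nsinc (B * u - k)) : ℝ) : ℂ) := by
    intro F
    have e : ∀ ω, (∑ k ∈ F, a k ω * (nsinc (B * t - k) : ℂ)) *
      conj (∑ k ∈ F, a k ω * (nsinc (B * u - k) : ℂ)) =
        ∑ j ∈ F, ∑ k ∈ F, (nsinc (B * t - j) * nsinc (B * u - k) : ℂ) *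
          (a j ω * conj (a k ω)) := by
      intro ω
      rw [map_sum, Finset.sum_mul_sum]
      refine Finset.sum_congr rfl fun j _ => Finset.sum_congr rfl fun k _ => ?_
      rw [map_mul, Complex.conj_ofReal]
      ring
    simp_rw [e]
    rw [integral_finsetSum _ fun j _ => integrable_finsetSum _ fun k _ =>
      ((ha j).integrable_mul_conj (ha k)).const_mul _, Complex.ofReal_sum]
    refine Finset.sum_congr rfl fun j hj => ?_
    rw [integral_finsetSum _ fun k _ => ((ha j).integrable_mul_conj (ha k)).const_mul _]
    simp_rw [integral_const_mul]
    rw [Finset.sum_eq_single_of_mem j hj fun k _ hk => by rw [hne j k hk.symm, mul_zero], hself]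
    push_cast
    ring
  simp_rw [h2] at h1
  have h3 := ((hasSum_nsinc_mul_nsinc (B * t) (B * u)).mul_left r)
  rw [← mul_sub] at h3
  -- `HasSum` is convergence along finite subsets of ℤ, the mode of summation in
  -- `IsSincInterpolation`, so both limits run along the same filter.
  exact tendsto_nhds_unique h1 ((Complex.continuous_ofReal.tendsto _).comp h3)

/-- Orthogonality to `Z` passes from finite sums to their mean-square limit; used with `Z` a noise
value. -/
theorem integral_mul_conj_eq_zero (h : IsSincInterpolation μ B a X) (ha : ∀ k, MemLp (a k) 2 μ)
    {Z : Ω → ℂ} (hZ : MemLp Z 2 μ) (h0 : ∀ k, ∫ ω, a k ω * conj (Z ω) ∂μ = 0) (t : ℝ) :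
    ∫ ω, X t ω * conj (Z ω) ∂μ = 0 := by
  have h1 := tendsto_integral_mul_conj (memLp_sum ha B t) (fun _ => hZ) (h t).1 hZ
    (h.tendsto_sub t) (by simp)
  have h2 : ∀ F : Finset ℤ, ∫ ω, (∑ k ∈ F, a k ω * (nsinc (B * t - k) : ℂ)) * conj (Z ω) ∂μ =
      0 := by
    intro F
    have e : ∀ ω, (∑ k ∈ F, a k ω * (nsinc (B * t - k) : ℂ)) * conj (Z ω) =
        ∑ k ∈ F, (nsinc (B * t - k) : ℂ) * (a k ω * conj (Z ω)) := by
      intro ω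
      rw [Finset.sum_mul]
      exact Finset.sum_congr rfl fun k _ => by ring
    simp_rw [e]
    rw [integral_finsetSum _ fun k _ => ((ha k).integrable_mul_conj hZ).const_mul _]
    exact Finset.sum_eq_zero fun k _ => by rw [integral_const_mul, h0, mul_zero]
  simp_rw [h2] at h1
  exact tendsto_nhds_unique h1 tendsto_const_nhds

end IsSincInterpolation

/-! ### Band-limited white processes and their filtered power -/

/-- A second-order process whose correlations are `E[X(t) X(u)^*] = ρ sinc(B (t - u))`. -/
structure IsBandlimitedWhite (μ : Measure Ω) (B ρ : ℝ) (X : ℝ → Ω → ℂ) : Prop where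
  memLp : ∀ t, MemLp (X t) 2 μ
  corr : ∀ t u, ∫ ω, X t ω * conj (X u ω) ∂μ = ((ρ * nsinc (B * (t - u)) : ℝ) : ℂ)

/-- Gaussianity serves here only to give finite second moments. Evenness of the sinc reconciles the
two sign conventions for the lag. -/
theorem IsBandlimitedWhiteGaussian.isBandlimitedWhite {B ρ : ℝ} {X : ℝ → Ω → ℂ}
    (h : IsBandlimitedWhiteGaussian μ B ρ X) : IsBandlimitedWhite μ B ρ X where
  memLp t := (h.gaussian.hasGaussianLaw_eval t).memLp_two
  corr t u := by
    have := h.autocorr t (u - t)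
    rw [add_sub_cancel] at this
    rw [this, ← nsinc_neg, ← mul_neg, neg_sub]

namespace IsBandlimitedWhite

variable {B ρ ρ' : ℝ} {X Y : ℝ → Ω → ℂ}

theorem integral_norm_sq (h : IsBandlimitedWhite μ B ρ X) (t : ℝ) :
    ∫ ω, ‖X t ω‖ ^ 2 ∂μ = ρ := by
  have := h.corr t t
  rw [← ofReal_integral_norm_sq, sub_self, mul_zero, nsinc_zero, mul_one] at this
  exact_mod_cast this

theorem nonneg (h : IsBandlimitedWhite μ B ρ X) : 0 ≤ ρ := by
  rw [← h.integral_norm_sq 0]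
  positivity

theorem add (hX : IsBandlimitedWhite μ B ρ X) (hY : IsBandlimitedWhite μ B ρ' Y)
    (h0 : ∀ t u, ∫ ω, X t ω * conj (Y u ω) ∂μ = 0) :
    IsBandlimitedWhite μ B (ρ + ρ') (fun t ω => X t ω + Y t ω) where
  memLp t := (hX.memLp t).add (hY.memLp t)
  corr t u := by
    have h0' : ∫ ω, Y t ω * conj (X u ω) ∂μ = 0 := by
      have := congrArg conj (h0 u t)
      rw [← integral_conj, map_zero] at this
      rw [← this]
      simp [mul_comm]
    have e : ∀ ω, (X t ω + Y t ω) * conj (X u ω + Y u ω) =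
        (X t ω * conj (X u ω) + X t ω * conj (Y u ω)) +
          (Y t ω * conj (X u ω) + Y t ω * conj (Y u ω)) := fun ω => by
      rw [map_add]
      ring
    simp_rw [e]
    have i1 := (hX.memLp t).integrable_mul_conj (hX.memLp u)
    have i2 := (hX.memLp t).integrable_mul_conj (hY.memLp u)
    have i3 := (hY.memLp t).integrable_mul_conj (hX.memLp u)
    have i4 := (hY.memLp t).integrable_mul_conj (hY.memLp u)
    refine (integral_add (i1.add i2) (i3.add i4)).trans ?_
    rw [integral_add' i1 i2, integral_add' i3 i4, h0, h0', hX.corr, hY.corr]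
    push_cast
    ring

/-- The power of a filtered band-limited white process. -/
theorem integral_norm_sq_tapConv (h : IsBandlimitedWhite μ B ρ X) (hB : B ≠ 0) {ι : Type*}
    [Fintype ι] (a : ι → ℂ) (τ : ι → ℝ) (t : ℝ) :
    ∫ ω, ‖tapConv a τ X t ω‖ ^ 2 ∂μ =
      ρ / B * ∫ f in (-(B / 2))..(B / 2), ‖tapFreq a τ f‖ ^ 2 := by
  apply Complex.ofReal_injective
  rw [ofReal_integral_norm_sq, Complex.ofReal_mul, ← intervalIntegral.integral_ofReal]
  have e1 : ∀ ω, tapConv a τ X t ω * conj (tapConv a τ X t ω) =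
      ∑ i, ∑ j, (a i * conj (a j)) * (X (t - τ i) ω * conj (X (t - τ j) ω)) := by
    intro ω
    rw [tapConv, map_sum, Finset.sum_mul_sum]
    refine Finset.sum_congr rfl fun i _ => Finset.sum_congr rfl fun j _ => ?_
    rw [map_mul]
    ring
  have e2 : ∀ f : ℝ, ((‖tapFreq a τ f‖ ^ 2 : ℝ) : ℂ) = ∑ i, ∑ j, (a i * conj (a j)) *
      Complex.exp (2 * Real.pi * f * (τ j - τ i : ℝ) * Complex.I) := by
    intro f
    rw [Complex.ofReal_pow, ← Complex.mul_conj', tapFreq, map_sum, Finset.sum_mul_sum]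
    refine Finset.sum_congr rfl fun i _ => Finset.sum_congr rfl fun j _ => ?_
    rw [map_mul, ← conj_exp_two_pi_mul_I f (τ j), Complex.conj_conj, mul_mul_mul_comm,
      ← Complex.exp_add]
    congr 2
    push_cast
    ring
  simp_rw [e1, e2]
  rw [integral_finsetSum _ fun i _ => integrable_finsetSum _ fun j _ =>
      ((h.memLp _).integrable_mul_conj (h.memLp _)).const_mul _,
    intervalIntegral.integral_finsetSum fun i _ => Continuous.intervalIntegrable (by fun_prop) _ _,
    Finset.mul_sum]
  refine Finset.sum_congr rfl fun i _ => ?_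
  rw [integral_finsetSum _ fun j _ =>
      ((h.memLp _).integrable_mul_conj (h.memLp _)).const_mul _,
    intervalIntegral.integral_finsetSum fun j _ => Continuous.intervalIntegrable (by fun_prop) _ _,
    Finset.mul_sum]
  refine Finset.sum_congr rfl fun j _ => ?_
  -- The lag between taps $i$ and $j$ is $(t-\tau_i)-(t-\tau_j)=\tau_j-\tau_i$: `t` drops out, so
  -- the power is constant in time.
  rw [integral_const_mul, intervalIntegral.integral_const_mul, h.corr, integral_exp_band,
    sub_sub_sub_cancel_left]
  have : (B : ℂ) ≠ 0 := by exact_mod_cast hB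
  push_cast
  field_simp

theorem mse_eq (h : IsBandlimitedWhite μ B ρ X) (hB : B ≠ 0) (fc : ℝ) {M N : ℕ}
    (α : Fin (M + 1) → ℂ) (τ : Fin (M + 1) → ℝ) (d : Fin N → ℝ) (w : Fin N → ℂ) (t : ℝ) :
    mse μ fc α τ d X w t = ρ / B * bandMismatch B fc α τ d w := by
  -- Channel minus canceller is a single tap filter, indexed by the disjoint union of the taps.
  have := h.integral_norm_sq_tapConv hB (Sum.elim α (-mtdCoeff fc d w)) (Sum.elim τ d) t
  rw [mse, bandMismatch]
  convert this using 4
  · simp [approxError, tapConv, sub_eq_add_neg]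
  · simp [tapFreq, sub_eq_add_neg]

end IsBandlimitedWhite

/-! ### Time averages and the power spectral density -/

theorem hasTimeAverage_const {E : Type*} [NormedAddCommGroup E] [NormedSpace ℝ E] [CompleteSpace E]
    (a : E) :
    HasTimeAverage (fun _ => a) a := by
  refine ⟨fun T => intervalIntegrable_const, tendsto_const_nhds.congr' ?_⟩
  filter_upwards [eventually_gt_atTop 0] with T hT
  rw [intervalIntegral.integral_const, smul_smul, sub_neg_eq_add, ← two_mul,
    inv_mul_cancel₀ (by positivity), one_smul]

theorem HasTimeAverage.unique {E : Type*} [NormedAddCommGroup E] [NormedSpace ℝ E] {g : ℝ → E}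
    {a b : E} (ha : HasTimeAverage g a) (hb : HasTimeAverage g b) : a = b :=
  tendsto_nhds_unique ha.2 hb.2

/-- The flat power spectral density of total mass `ρ` on the band `(-B/2, B/2]`. -/
noncomputable def flatPSD (B ρ : ℝ) : ℝ → ℝ :=
  (Set.Ioc (-(B / 2)) (B / 2)).indicator fun _ => ρ / B

theorem integral_flatPSD {B : ℝ} (hB : 0 < B) (ρ : ℝ) : ∫ f, flatPSD B ρ f = ρ := by
  rw [flatPSD, integral_indicator measurableSet_Ioc, setIntegral_const]
  simp only [Measure.real, Real.volume_Ioc, sub_neg_eq_add, add_halves, smul_eq_mul]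
  rw [ENNReal.toReal_ofReal hB.le]
  field_simp

theorem IsBandlimitedWhite.isPSD_flatPSD {B ρ : ℝ} {X : ℝ → Ω → ℂ} (hB : 0 < B)
    (h : IsBandlimitedWhite μ B ρ X) : IsPSD μ X (flatPSD B ρ) where
  nonneg := fun f => Set.indicator_nonneg (fun _ _ => div_nonneg h.nonneg hB.le) f
  integrable := (integrable_indicator_iff measurableSet_Ioc).2 (by simp)
  autocorr τ := by
    have e : ∫ f : ℝ, (flatPSD B ρ f : ℂ) * Complex.exp (2 * Real.pi * f * τ * Complex.I) =
        ((ρ * nsinc (B * τ) : ℝ) : ℂ) := by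
      have e1 : ∀ f : ℝ, (flatPSD B ρ f : ℂ) * Complex.exp (2 * Real.pi * f * τ * Complex.I) =
          (Set.Ioc (-(B / 2)) (B / 2)).indicator (fun f : ℝ => ((ρ / B : ℝ) : ℂ) *
            Complex.exp (2 * Real.pi * f * τ * Complex.I)) f := by
        intro f
        by_cases hf : f ∈ Set.Ioc (-(B / 2)) (B / 2) <;> simp [flatPSD, hf]
      simp_rw [e1]
      rw [integral_indicator measurableSet_Ioc, integral_const_mul,
        ← intervalIntegral.integral_of_le (by linarith), integral_exp_band]
      have : (B : ℂ) ≠ 0 := by exact_mod_cast hB.ne'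
      push_cast
      field_simp
    rw [e]
    simp_rw [h.corr, add_sub_cancel_left]
    exact hasTimeAverage_const _

end SecondOrder

/-! ### Symmetry of the symbols and independence from the noise -/

section Symbols

theorem map_neg_circGaussian (v : ℝ≥0) : (circGaussian v).map (fun z => -z) = circGaussian v := by
  have hm : Measurable (fun p : ℝ × ℝ => (⟨p.1, p.2⟩ : ℂ)) :=
    Complex.measurableEquivRealProd.symm.measurable
  have hneg : ((gaussianReal 0 (v / 2)).prod (gaussianReal 0 (v / 2))).map
      (Prod.map (fun x => -x) (fun x => -x)) =
        (gaussianReal 0 (v / 2)).prod (gaussianReal 0 (v / 2)) := by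
    rw [← Measure.map_prod_map _ _ measurable_neg measurable_neg, gaussianReal_map_neg, neg_zero]
  rw [circGaussian, Measure.map_map measurable_neg hm]
  conv_rhs => rw [← hneg, Measure.map_map hm (by fun_prop)]
  rfl

/-- The symmetry of the law gives $I=-I$. Integrability of `g` is not needed, since the default
value 0 of the integral agrees with the claim. -/
theorem integral_circGaussian_of_odd (v : ℝ≥0) {g : ℂ → ℂ} (hg : ∀ z, g (-z) = -g z) :
    ∫ z, g z ∂circGaussian v = 0 := by
  have h : ∫ z, g z ∂circGaussian v = ∫ z, g (-z) ∂circGaussian v := by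
    conv_lhs => rw [← map_neg_circGaussian]
    exact (MeasurableEquiv.neg ℂ).measurableEmbedding.integral_map g
  simp_rw [hg, integral_neg] at h
  exact self_eq_neg.1 h

theorem measurable_iqImbalance (b₀ b₁ : ℂ) : Measurable (iqImbalance b₀ b₁) := by
  unfold iqImbalance
  fun_prop

theorem iqImbalance_neg (b₀ b₁ z : ℂ) : iqImbalance b₀ b₁ (-z) = -iqImbalance b₀ b₁ z := by
  simp only [iqImbalance, map_neg]
  ring

theorem measurable_paNonlinear (c : ℕ → ℂ) : Measurable (paNonlinear c) := by
  refine Measurable.tsum fun j => ?_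
  unfold paTerm
  fun_prop

/-- Oddness holds at every point: where the series diverges, both `tsum`s take the default value 0.
-/
theorem paNonlinear_neg (c : ℕ → ℂ) (v : ℂ) : paNonlinear c (-v) = -paNonlinear c v := by
  simp [paNonlinear, paTerm, tsum_neg]

variable {Ω : Type*} [MeasurableSpace Ω] {μ : Measure Ω}

/-- Jointly Gaussian complex variables whose covariance and pseudo-covariance vanish are
independent. -/
theorem indepFun_of_hasGaussianLaw_of_uncorrelated {X Y : Ω → ℂ}
    (h : HasGaussianLaw (fun ω => (X ω, Y ω)) μ) (hY0 : ∫ ω, Y ω ∂μ = 0)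
    (h1 : ∫ ω, X ω * conj (Y ω) ∂μ = 0) (h2 : ∫ ω, X ω * Y ω ∂μ = 0) : IndepFun X Y μ := by
  have := h.isProbabilityMeasure
  have hX := h.fst.memLp_two
  have hY := h.snd.memLp_two
  refine h.indepFun_of_covariance_inner fun x y => ?_
  rw [covariance_eq_sub (hX.const_inner x) (hY.const_inner y)]
  have hm : μ[fun ω => inner ℝ y (Y ω)] = 0 := by
    rw [integral_inner h.snd.integrable, hY0, inner_zero_right]
  rw [hm, mul_zero, sub_zero]
  have i1 : Integrable (fun ω => (conj x * y) * (X ω * conj (Y ω))) μ :=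
    (hX.integrable_mul_conj hY).const_mul _
  have i2 : Integrable (fun ω => (conj x * conj y) * (X ω * Y ω)) μ :=
    (hX.integrable_mul hY).const_mul _
  -- This is $\operatorname{Re}a\,\operatorname{Re}b=\tfrac12\operatorname{Re}(a\bar b+ab)$ with
  -- $a=\bar xX$, $b=\bar yY$: real covariances combine covariance and pseudo-covariance.
  have e : ∀ ω, ((fun ω => inner ℝ x (X ω)) * fun ω => inner ℝ y (Y ω)) ω =
      RCLike.re ((conj x * y) * (X ω * conj (Y ω)) + (conj x * conj y) * (X ω * Y ω)) / 2 := by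
    intro ω
    simp only [Pi.mul_apply, Complex.inner, RCLike.re_eq_complex_re, Complex.add_re,
      Complex.mul_re, Complex.mul_im, Complex.conj_re, Complex.conj_im]
    ring
  simp_rw [e]
  have h0 : ∫ ω, (conj x * y) * (X ω * conj (Y ω)) + (conj x * conj y) * (X ω * Y ω) ∂μ = 0 := by
    rw [integral_add i1 i2, integral_const_mul, integral_const_mul, h1, h2]
    simp
  rw [integral_div]
  refine div_eq_zero_iff.2 (Or.inl ?_)
  exact (integral_re (i1.add i2)).trans ((congrArg RCLike.re h0).trans (map_zero _))

/-- An odd memoryless distortion of pairwise independent circularly symmetric Gaussian symbols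
has white samples. -/
theorem exists_integral_mul_conj_odd_comp {v : ℝ≥0} {s : ℤ → Ω → ℂ}
    (hlaw : ∀ k, HasLaw (s k) (circGaussian v) μ)
    (hindep : Pairwise (fun j k => IndepFun (s j) (s k) μ)) {g : ℂ → ℂ} (hg : Measurable g)
    (hodd : ∀ z, g (-z) = -g z) :
    ∃ r : ℝ, (∀ k, ∫ ω, g (s k ω) * conj (g (s k ω)) ∂μ = r) ∧
      ∀ j k, j ≠ k → ∫ ω, g (s j ω) * conj (g (s k ω)) ∂μ = 0 := by
  refine ⟨∫ z, ‖g z‖ ^ 2 ∂circGaussian v, fun k => ?_, fun j k hjk => ?_⟩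
  · rw [ofReal_integral_norm_sq]
    exact (hlaw k).integral_comp (f := fun z => g z * conj (g z)) (by fun_prop)
  · have hconj : Measurable fun z => conj (g z) := by fun_prop
    have h := ((hindep hjk).comp hg hconj).integral_mul_eq_mul_integral
      (hg.comp_aemeasurable (hlaw j).aemeasurable).aestronglyMeasurable
      (hconj.comp_aemeasurable (hlaw k).aemeasurable).aestronglyMeasurable
    rw [(hlaw j).integral_comp hg.aestronglyMeasurable, integral_circGaussian_of_odd v hodd,
      zero_mul] at h
    exact h

/-- An odd memoryless distortion of a circularly symmetric Gaussian symbol is uncorrelated with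
any independent variable. -/
theorem integral_odd_comp_mul_conj_eq_zero {v : ℝ≥0} {s Y : Ω → ℂ}
    (hlaw : HasLaw s (circGaussian v) μ) (hY : AEMeasurable Y μ) (hindep : IndepFun s Y μ)
    {g : ℂ → ℂ} (hg : Measurable g) (hodd : ∀ z, g (-z) = -g z) :
    ∫ ω, g (s ω) * conj (Y ω) ∂μ = 0 := by
  have hconj : Measurable (fun z : ℂ => conj z) := by fun_prop
  have h := (hindep.comp hg hconj).integral_mul_eq_mul_integral
    (hg.comp_aemeasurable hlaw.aemeasurable).aestronglyMeasurable
    (hconj.comp_aemeasurable hY).aestronglyMeasurable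
  rw [hlaw.integral_comp hg.aestronglyMeasurable, integral_circGaussian_of_odd v hodd,
    zero_mul] at h
  exact h

/-- The interpolation of oddly distorted symbols plus the Gaussian noise is band-limited white. -/
theorem exists_isBandlimitedWhite_add_noise {B ρn : ℝ} {v : ℝ≥0} {s : ℤ → Ω → ℂ}
    {n X : ℝ → Ω → ℂ} {g : ℂ → ℂ} (hlaw : ∀ k, HasLaw (s k) (circGaussian v) μ)
    (hindep : Pairwise (fun j k => IndepFun (s j) (s k) μ))
    (hn : IsBandlimitedWhiteGaussian μ B ρn n)
    (hjoint : ∀ k t, HasGaussianLaw (fun ω => (s k ω, n t ω)) μ)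
    (huncorr : ∀ k t, ∫ ω, s k ω * conj (n t ω) ∂μ = 0 ∧ ∫ ω, s k ω * n t ω ∂μ = 0)
    (hg : Measurable g) (hodd : ∀ z, g (-z) = -g z)
    (hmem : ∀ k, MemLp (fun ω => g (s k ω)) 2 μ)
    (hX : IsSincInterpolation μ B (fun k ω => g (s k ω)) X) :
    ∃ ρ, IsBandlimitedWhite μ B ρ (fun t ω => X t ω + n t ω) := by
  obtain ⟨r, hself, hne⟩ := exists_integral_mul_conj_odd_comp hlaw hindep hg hodd
  have hXw : IsBandlimitedWhite μ B r X :=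
    ⟨fun t => (hX t).1, hX.integral_mul_conj hmem hself hne⟩
  refine ⟨_, hXw.add hn.isBandlimitedWhite fun t u => ?_⟩
  refine hX.integral_mul_conj_eq_zero hmem (hn.isBandlimitedWhite.memLp u) (fun k => ?_) t
  exact integral_odd_comp_mul_conj_eq_zero (hlaw k) (hn.gaussian.aemeasurable u)
    (indepFun_of_hasGaussianLaw_of_uncorrelated (hjoint k u) (hn.centred u) (huncorr k u).1
      (huncorr k u).2) hg hodd

theorem memLp_iqImbalance {X : Ω → ℂ} (hX : MemLp X 2 μ) (b₀ b₁ : ℂ) :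
    MemLp (fun ω => iqImbalance b₀ b₁ (X ω)) 2 μ :=
  (hX.const_mul b₀).add (hX.star.const_mul b₁)

end Symbols

/-! ### The main theorem -/

theorem theorem1 {Ω : Type*} [MeasurableSpace Ω] (μ : Measure Ω) [IsProbabilityMeasure μ]
    (B fc : ℝ) (hB : 0 < B)
    -- The symbols: `CN(0, ρℓ)`, independent at different sampling points.
    (ρℓ : ℝ≥0) (s : ℤ → Ω → ℂ)
    (hlaw : ∀ k, HasLaw (s k) (circGaussian ρℓ) μ)
    (hindep : Pairwise (fun j k => IndepFun (s j) (s k) μ))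
    -- The Tx noise: jointly Gaussian and uncorrelated with the symbols.
    (ρn : ℝ) (n : ℝ → Ω → ℂ) (hn : IsBandlimitedWhiteGaussian μ B ρn n)
    (hjoint : ∀ k t, HasGaussianLaw (fun ω => (s k ω, n t ω)) μ)
    (huncorr : ∀ k t, ∫ ω, s k ω * conj (n t ω) ∂μ = 0 ∧ ∫ ω, s k ω * n t ω ∂μ = 0)
    -- I/Q imbalance and the odd-order nonlinearity, of finite power, whose input is the
    -- I/Q-imbalanced symbol or its conjugate.
    (b₀ b₁ : ℂ) (c : ℕ → ℂ) (v : ℤ → Ω → ℂ)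
    (hv : (∀ k ω, v k ω = iqImbalance b₀ b₁ (s k ω)) ∨
      (∀ k ω, v k ω = conj (iqImbalance b₀ b₁ (s k ω))))
    (hsummable : ∀ k, ∀ᵐ ω ∂μ, Summable (paTerm c (v k ω)))
    (hpower : ∀ k, MemLp (fun ω => paNonlinear c (v k ω)) 2 μ)
    -- The linear, the nonlinear and the total Tx signal.
    (sl snl sb : ℝ → Ω → ℂ)
    (hsl : IsSincInterpolation μ B (fun k ω => iqImbalance b₀ b₁ (s k ω)) sl)
    (hsnl : IsSincInterpolation μ B (fun k ω => paNonlinear c (v k ω)) snl)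
    (hsb : ∀ t ω, sb t ω = sl t ω + snl t ω + n t ω) :
    ∃ (P : ℝ → ℝ) (ρt : ℝ),
      -- `ρt` is the average Tx power, the integral of the power spectral density
      IsPSD μ sb P ∧ ρt = ∫ f, P f ∧ HasTimeAverage (fun t => ∫ ω, ‖sb t ω‖ ^ 2 ∂μ) ρt ∧
      -- for every channel and all delays of the canceller
      ∀ (M N : ℕ) (α : Fin (M + 1) → ℂ) (τ : Fin (M + 1) → ℝ) (d : Fin N → ℝ),
        -- the time-averaged mean square error for every weight vector
        (∀ w : Fin N → ℂ,
          HasTimeAverage (mse μ fc α τ d sb w) (ρt / B * bandMismatch B fc α τ d w)) ∧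
        -- the minima over the weights exist and coincide
        ∃ m : ℝ,
          IsLeast {a | ∃ w : Fin N → ℂ, HasTimeAverage (mse μ fc α τ d sb w) a} m ∧
          IsLeast (Set.range fun w : Fin N → ℂ => ρt / B * bandMismatch B fc α τ d w) m ∧
          -- the same errors and the same minimum for a stationary white Gaussian input
          ∀ (Ω' : Type*) [MeasurableSpace Ω'] (ν : Measure Ω') [IsProbabilityMeasure ν]
            (x : ℝ → Ω' → ℂ), IsBandlimitedWhiteGaussian ν B 1 x → ∀ t : ℝ,
            (∀ w : Fin N → ℂ,
              ρt * mse ν fc α τ d x w t = ρt / B * bandMismatch B fc α τ d w) ∧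
            IsLeast (Set.range fun w : Fin N → ℂ => ρt * mse ν fc α τ d x w t) m := by
  obtain ⟨ρt, hw⟩ : ∃ ρ, IsBandlimitedWhite μ B ρ sb := by
    have hsmem : ∀ k, MemLp (s k) 2 μ := fun k => (hjoint k 0).fst.memLp_two
    -- Both choices of amplifier input are odd measurable functions of the symbol, which is all that
    -- is used about `v` from here on.
    obtain ⟨φ, hφm, hφodd, hvφ⟩ : ∃ φ : ℂ → ℂ, Measurable φ ∧ (∀ z, φ (-z) = -φ z) ∧
        ∀ k ω, v k ω = φ (s k ω) := by
      rcases hv with hv | hv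
      · exact ⟨_, measurable_iqImbalance b₀ b₁, iqImbalance_neg b₀ b₁, hv⟩
      · refine ⟨fun z => conj (iqImbalance b₀ b₁ z), ?_, fun z => ?_, hv⟩
        · have := measurable_iqImbalance b₀ b₁
          fun_prop
        · simp only [iqImbalance_neg, map_neg]
    simp_rw [hvφ] at hpower hsnl
    have hmem := fun k => memLp_iqImbalance (hsmem k) b₀ b₁
    obtain ⟨ρ, h⟩ := exists_isBandlimitedWhite_add_noise
      (g := fun z => iqImbalance b₀ b₁ z + paNonlinear c (φ z)) hlaw hindep hn hjoint huncorr
      ((measurable_iqImbalance b₀ b₁).add ((measurable_paNonlinear c).comp hφm))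
      (fun z => by rw [iqImbalance_neg, hφodd, paNonlinear_neg, neg_add])
      (fun k => (hmem k).add (hpower k)) (hsl.add hsnl hmem hpower)
    refine ⟨ρ, ?_⟩
    rwa [show sb = fun t ω => sl t ω + snl t ω + n t ω from funext fun t => funext (hsb t)]
  refine ⟨flatPSD B ρt, ρt, hw.isPSD_flatPSD hB, (integral_flatPSD hB ρt).symm, ?_, ?_⟩
  · simp_rw [hw.integral_norm_sq]
    exact hasTimeAverage_const _
  intro M N α τ d
  have hmse : ∀ w, HasTimeAverage (mse μ fc α τ d sb w) (ρt / B * bandMismatch B fc α τ d w) := by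
    intro w
    rw [show mse μ fc α τ d sb w = fun _ => ρt / B * bandMismatch B fc α τ d w from
      funext fun t => hw.mse_eq hB.ne' fc α τ d w t]
    exact hasTimeAverage_const _
  obtain ⟨w₀, hw₀⟩ := exists_forall_bandMismatch_le hB fc α τ d
  -- As $\rho_t/B\ge 0$, the minimiser `w₀` of the band mismatch minimises all three expressions at
  -- once.
  have hle : ∀ w, ρt / B * bandMismatch B fc α τ d w₀ ≤ ρt / B * bandMismatch B fc α τ d w :=
    fun w => mul_le_mul_of_nonneg_left (hw₀ w) (div_nonneg hw.nonneg hB.le)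
  refine ⟨hmse, ρt / B * bandMismatch B fc α τ d w₀, ⟨⟨w₀, hmse w₀⟩, ?_⟩, ⟨⟨w₀, rfl⟩, ?_⟩, ?_⟩
  · rintro a ⟨w, ha⟩
    rw [ha.unique (hmse w)]
    exact hle w
  · rintro _ ⟨w, rfl⟩
    exact hle w
  · intro Ω' _ ν _ x hx t
    have heq : ∀ w, ρt * mse ν fc α τ d x w t = ρt / B * bandMismatch B fc α τ d w := by
      intro w
      rw [hx.isBandlimitedWhite.mse_eq hB.ne']
      ring
    refine ⟨heq, ⟨w₀, heq w₀⟩, ?_⟩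
    rintro _ ⟨w, rfl⟩
    change _ ≤ ρt * mse ν fc α τ d x w t
    rw [heq w]
    exact hle w
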